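/- For a group $G$ and a characteristic subgroup $K$ of $G$, let $\mathrm{Aut}(G)\to\mathrm{Aut}(G/K)$ be the natural homomorphism. A finitely generated group $G$ has the Congruence Subgroup Property if every finite-index subgroup of $\mathrm{Aut}(G)$ contains $\ker(\mathrm{Aut}(G)\to\mathrm{Aut}(G/K))$ for some characteristic subgroup $K$ of finite index in $G$. Let $F_2$ be the free group on two generators and let $\Phi=F_2/F_2''$, where $F_2'=[F_2,F_2]$ and $F_2''=[F_2',F_2']$, be the free metabelian group on two generators. **Theorem.** $\Phi$ does not have the Congruence Subgroup Property; that is, there is a finite-index subgroup $H\le\mathrm{Aut}(\Phi)$ such that $\ker(\mathrm{Aut}(\Phi)\to\mathrm{Aut}(\Phi/K))\not\subseteq H$ for every characteristic subgroup $K$ of finite index in $\Phi$. -/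

import Mathlib

/-- The natural homomorphism `Aut(G) → Aut(G/K)`, for a characteristic subgroup `K` of `G`:
the automorphism `φ` induces `gK ↦ φ(g)K`. -/
def autQuotient {G : Type*} [Group G] (K : Subgroup G) [K.Characteristic] :
    MulAut G →* MulAut (G ⧸ K) where
  toFun φ := QuotientGroup.congr K K φ (Subgroup.characteristic_iff_map_eq.mp inferInstance φ)
  map_one' := by
    ext x
    induction x using QuotientGroup.induction_on
    rfl
  map_mul' φ ψ := by
    ext x
    induction x using QuotientGroup.induction_on
    rfl

/-- The congruence subgroup `ker (Aut(G) → Aut(G/K))` of `Aut(G)`. -/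
def congruenceKernel {G : Type*} [Group G] (K : Subgroup G) [K.Characteristic] :
    Subgroup (MulAut G) :=
  (autQuotient K).ker

/-- The congruence subgroup property of a group `G`: every finite-index subgroup of `Aut(G)`
contains `ker (Aut(G) → Aut(G/K))` for some characteristic subgroup `K` of finite index in `G`. -/
def HasCSP (G : Type*) [Group G] : Prop :=
  ∀ H : Subgroup (MulAut G), H.FiniteIndex →
    ∃ (K : Subgroup G) (_ : K.Characteristic), K.FiniteIndex ∧ congruenceKernel K ≤ H

/-- The free solvable group on `m` generators of solvability length `r`: the quotient of the free
group `F` on `m` generators by the `r`-th term of its derived series, where `F⁽⁰⁾ = F` and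
`F⁽ʳ⁺¹⁾ = [F⁽ʳ⁾, F⁽ʳ⁾]`. -/
abbrev FreeSolvableGroup (m r : ℕ) : Type :=
  FreeGroup (Fin m) ⧸ derivedSeries (FreeGroup (Fin m)) r

/-- The free metabelian group on two generators, `F₂ / F₂''`. -/
abbrev FreeMetabelianGroupTwo : Type := FreeSolvableGroup 2 2

/-! In a finite quotient `Q = Φ/K`, the commutator subgroup is abelian and is a cyclic module over
the group ring of the abelianization, generated by one commutator. Endomorphisms of such a module
commute, so the automorphisms of `Q` trivial on its abelianization form a metabelian group
(`commutator_commutator_torelli`). Hence, if automorphisms of `Φ` act on `ℤ²` trivially modulo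
`|Q|`, double commutators of them act trivially on `Q`.

But `GL₂(ℤ)` has a free subgroup of finite index, the Sanov group, which has non-congruence
subgroups. Map it to `S₅`; the kernel has finite index in `GL₂(ℤ)`, and its preimage in `Aut(Φ)` is
the required `H`. For every `n` there are words of level `n` whose images in `S₅` are prescribed
3-cycles with a nontrivial double commutator. The corresponding double commutator in `Aut(Φ)` lies
in the congruence kernel of `K` but not in `H`. -/

open scoped commutatorElement
open scoped Matrix MatrixGroups

/-! ### Automorphisms of two-generator metabelian groups -/

section Metabelian

variable {G : Type*} [Group G]

/-- In a group generated by two elements, a normal subgroup containing the commutator of the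
generators contains the commutator subgroup. -/
theorem commutator_le_of_closure_pair_eq_top {x y : G} (h : Subgroup.closure {x, y} = ⊤)
    (N : Subgroup G) [N.Normal] (hN : ⁅x, y⁆ ∈ N) : commutator G ≤ N := by
  have hxy : (x : G ⧸ N) * y = y * x := by
    rw [← commutatorElement_eq_one_iff_mul_comm]
    exact (QuotientGroup.eq_one_iff _).2 hN
  have hgen : ∀ z : G, (z : G ⧸ N) * x = x * z → (z : G ⧸ N) * y = y * z →
      ∀ g : G, (z : G ⧸ N) * g = g * z := by
    intro z hx hy g
    have : Subgroup.closure {x, y} ≤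
        (Subgroup.centralizer {(z : G ⧸ N)}).comap (QuotientGroup.mk' N) := by
      rw [Subgroup.closure_le]
      rintro w (rfl | rfl)
      · simpa [Subgroup.mem_centralizer_iff] using hx
      · simpa [Subgroup.mem_centralizer_iff] using hy
    have hg := this (h ▸ Subgroup.mem_top g)
    simpa [Subgroup.mem_centralizer_iff] using hg
  have hx := hgen x rfl hxy
  have hy := hgen y hxy.symm rfl
  rw [commutator_def, Subgroup.commutator_le]
  intro a _ b _
  rw [← QuotientGroup.eq_one_iff]
  exact commutatorElement_eq_one_iff_mul_comm.2 (hgen a (hx a).symm (hy a).symm b)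

/-- Equivariant endomorphisms of a cyclic module over a commutative monoid of endomorphisms
commute. -/
theorem equivariant_endomorphisms_commute {ι A : Type*} [CommGroup A] (ρ : ι → A →* A)
    (hρ : ∀ g g' a, ρ g (ρ g' a) = ρ g' (ρ g a)) (c : A)
    (hc : ∀ T : Subgroup A, c ∈ T → (∀ g, ∀ a ∈ T, ρ g a ∈ T) → T = ⊤)
    (φ ψ : A →* A) (hφ : ∀ g a, φ (ρ g a) = ρ g (φ a)) (hψ : ∀ g a, ψ (ρ g a) = ρ g (ψ a))
    (a : A) : φ (ψ a) = ψ (φ a) := by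
  -- The values at `c` of the endomorphisms that commute with all equivariant ones; these play the
  -- role of multiplications by ring elements. Cyclicity makes `φ` itself one of them.
  let T : Subgroup A :=
    { carrier := {z | ∃ h : A →* A, (∀ θ : A →* A, (∀ g a, θ (ρ g a) = ρ g (θ a)) →
        ∀ a, h (θ a) = θ (h a)) ∧ h c = z}
      one_mem' := ⟨1, by simp, by simp⟩
      mul_mem' := by
        rintro _ _ ⟨h, hh, rfl⟩ ⟨k, hk, rfl⟩
        exact ⟨h * k, fun θ hθ a => by simp [hh θ hθ, hk θ hθ], rfl⟩
      inv_mem' := by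
        rintro _ ⟨h, hh, rfl⟩
        exact ⟨h⁻¹, fun θ hθ a => by simp [hh θ hθ], rfl⟩ }
  have hT : T = ⊤ := by
    refine hc T ⟨MonoidHom.id A, by simp, rfl⟩ ?_
    rintro g _ ⟨h, hh, rfl⟩
    exact ⟨(ρ g).comp h, fun θ hθ a => by simp [hh θ hθ, hθ], rfl⟩
  obtain ⟨h, hh, hhc⟩ : φ c ∈ T := hT ▸ Subgroup.mem_top _
  have hφh : ∀ a, φ a = h a := by
    have : φ.eqLocus h = ⊤ := by
      refine hc _ hhc.symm ?_
      intro g a (ha : φ a = h a)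
      change φ (ρ g a) = h (ρ g a)
      rw [hφ, ha, hh (ρ g) fun g' a => hρ _ _ _]
    intro a
    exact (this ▸ Subgroup.mem_top a : a ∈ φ.eqLocus h)
  rw [hφh, hφh, hh ψ hψ]

/-- In a metabelian group generated by two elements, automorphisms that are trivial on the
abelianization commute on the commutator subgroup. -/
theorem mulAut_comm_on_commutator (hG : derivedSeries G 2 = ⊥) {x y : G}
    (h : Subgroup.closure {x, y} = ⊤) (β γ : MulAut G)
    (hβ : ∀ g, g⁻¹ * β g ∈ commutator G) (hγ : ∀ g, g⁻¹ * γ g ∈ commutator G)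
    {a : G} (ha : a ∈ commutator G) : β (γ a) = γ (β a) := by
  have hab : ∀ a ∈ commutator G, ∀ b ∈ commutator G, a * b = b * a := by
    intro a ha b hb
    rw [← commutatorElement_eq_one_iff_mul_comm, ← Subgroup.mem_bot, ← hG]
    rw [← derivedSeries_one] at ha hb
    exact Subgroup.commutator_mem_commutator ha hb
  let : CommGroup (commutator G) :=
    { (inferInstance : Group (commutator G)) with
      mul_comm := fun a b => Subtype.ext (hab a a.2 b b.2) }
  have hmap : ∀ β : MulAut G, ∀ a ∈ commutator G, β a ∈ commutator G := fun β a ha =>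
    (Subgroup.characteristic_iff_map_le.1 inferInstance β) (Subgroup.mem_map_of_mem _ ha)
  let R : MulAut G → commutator G →* commutator G := fun β =>
    (β.toMonoidHom.comp (commutator G).subtype).codRestrict _ fun a => hmap β a a.2
  have key := equivariant_endomorphisms_commute (fun g : G => R (MulAut.conj g)) ?_
    ⟨⁅x, y⁆, Subgroup.commutator_mem_commutator (Subgroup.mem_top x) (Subgroup.mem_top y)⟩ ?_
    (R β) (R γ) ?_ ?_ ⟨a, ha⟩
  · exact congrArg Subtype.val key
  · rintro g g' ⟨a, ha⟩
    apply Subtype.ext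
    change g * (g' * a * g'⁻¹) * g⁻¹ = g' * (g * a * g⁻¹) * g'⁻¹
    have h1 := hab a ha ((g' * g)⁻¹ * (g * g')) (by
      have : (g' * g)⁻¹ * (g * g') = ⁅g⁻¹, g'⁻¹⁆ := by simp [commutatorElement_def, mul_assoc]
      rw [this]
      exact Subgroup.commutator_mem_commutator (Subgroup.mem_top _) (Subgroup.mem_top _))
    calc g * (g' * a * g'⁻¹) * g⁻¹
        = g' * g * ((g' * g)⁻¹ * (g * g') * a) * (g * g')⁻¹ := by group
      _ = g' * g * (a * ((g' * g)⁻¹ * (g * g'))) * (g * g')⁻¹ := by rw [h1]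
      _ = _ := by group
  · intro T hcT hT
    have hnormal : (T.map (commutator G).subtype).Normal := by
      constructor
      rintro _ ⟨a, ha, rfl⟩ g
      exact ⟨_, hT g a ha, rfl⟩
    have := commutator_le_of_closure_pair_eq_top h (T.map (commutator G).subtype) ⟨_, hcT, rfl⟩
    rw [eq_top_iff]
    rintro ⟨a, ha⟩ _
    obtain ⟨b, hb, hba⟩ := this ha
    rwa [← show b = ⟨a, ha⟩ from Subtype.ext hba]
  all_goals
    rintro g ⟨a, ha⟩
    apply Subtype.ext
  -- Equivariance: `β g` and `g` differ by an element of the abelian commutator subgroup, so they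
  -- conjugate it in the same way.
  · change β (g * a * g⁻¹) = g * β a * g⁻¹
    have := hab _ (hβ g) _ (hmap β a ha)
    rw [map_mul, map_mul, map_inv]
    calc β g * β a * (β g)⁻¹ = g * (g⁻¹ * β g * β a) * (β g)⁻¹ := by group
      _ = _ := by rw [this]; group
  · change γ (g * a * g⁻¹) = g * γ a * g⁻¹
    have := hab _ (hγ g) _ (hmap γ a ha)
    rw [map_mul, map_mul, map_inv]
    calc γ g * γ a * (γ g)⁻¹ = g * (g⁻¹ * γ g * γ a) * (γ g)⁻¹ := by group
      _ = _ := by rw [this]; group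

/-- The automorphisms of a group `G` that act trivially on its abelianization. -/
def torelli (G : Type*) [Group G] : Subgroup (MulAut G) where
  carrier := {β | ∀ g, g⁻¹ * β g ∈ commutator G}
  one_mem' g := by simp
  mul_mem' {β γ} hβ hγ g := by
    have := mul_mem (hγ g) (hβ (γ g))
    simpa [mul_assoc] using this
  inv_mem' {β} hβ g := by
    have := inv_mem (hβ (β⁻¹ g))
    simpa [mul_assoc] using this

/-- The automorphisms of a metabelian group generated by two elements that act trivially on the
abelianization form a metabelian group. -/
theorem commutator_commutator_torelli (hG : derivedSeries G 2 = ⊥) {x y : G}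
    (h : Subgroup.closure {x, y} = ⊤) : ⁅⁅torelli G, torelli G⁆, ⁅torelli G, torelli G⁆⁆ = ⊥ := by
  have hle : ⁅torelli G, torelli G⁆ ≤ torelli G := by
    rw [Subgroup.commutator_le]
    intro β hβ γ hγ
    exact mul_mem (mul_mem (mul_mem hβ hγ) (inv_mem hβ)) (inv_mem hγ)
  let S : Subgroup (MulAut G) :=
    { carrier := {β | ∀ a ∈ commutator G, β a = a}
      one_mem' := fun a _ => rfl
      mul_mem' := fun {β γ} hβ hγ a ha => by
        change β (γ a) = a
        rw [hγ a ha, hβ a ha]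
      inv_mem' := fun {β} hβ a ha => by
        change β.symm a = a
        rw [MulEquiv.symm_apply_eq, hβ a ha] }
  have hS : ⁅torelli G, torelli G⁆ ≤ S := by
    rw [Subgroup.commutator_le]
    intro β hβ γ hγ a ha
    have hm := mulAut_comm_on_commutator hG h _ _ (inv_mem hβ) (inv_mem hγ) ha
    change β (γ (β⁻¹ (γ⁻¹ a))) = a
    rw [hm]
    simp
  rw [eq_bot_iff, Subgroup.commutator_le]
  intro β hβ γ hγ
  rw [Subgroup.mem_bot, commutatorElement_eq_one_iff_mul_comm]
  ext g
  change β (γ g) = γ (β g)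
  -- Both automorphisms fix the commutator subgroup pointwise, so composing them multiplies the
  -- displacements `g⁻¹ * β g` and `g⁻¹ * γ g`, which commute.
  have h1 := hS hβ _ (hle hγ g)
  have h2 := hS hγ _ (hle hβ g)
  rw [map_mul, map_inv, inv_mul_eq_iff_eq_mul] at h1 h2
  rw [h1, h2]
  have hab : ∀ a ∈ commutator G, ∀ b ∈ commutator G, a * b = b * a := by
    intro a ha b hb
    rw [← commutatorElement_eq_one_iff_mul_comm, ← Subgroup.mem_bot, ← hG]
    rw [← derivedSeries_one] at ha hb
    exact Subgroup.commutator_mem_commutator ha hb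
  have := hab _ (hle hβ g) _ (hle hγ g)
  calc β g * (g⁻¹ * γ g) = g * ((g⁻¹ * β g) * (g⁻¹ * γ g)) := by group
    _ = g * ((g⁻¹ * γ g) * (g⁻¹ * β g)) := by rw [this]
    _ = _ := by group

end Metabelian

/-! ### The Sanov subgroup: freeness and finite index -/

section Sanov


/-- The matrix `!![1, 2; 0, 1]`. -/
def upperTwo : GL (Fin 2) ℤ where
  val := !![1, 2; 0, 1]
  inv := !![1, -2; 0, 1]
  val_inv := by simp [Matrix.one_fin_two]
  inv_val := by simp [Matrix.one_fin_two]

/-- The matrix `!![1, 0; 2, 1]`. -/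
def lowerTwo : GL (Fin 2) ℤ where
  val := !![1, 0; 2, 1]
  inv := !![1, 0; -2, 1]
  val_inv := by simp [Matrix.one_fin_two]
  inv_val := by simp [Matrix.one_fin_two]

/-- The homomorphism from the free group of rank two onto the Sanov subgroup of `GL₂(ℤ)`. -/
def sanov : FreeGroup (Fin 2) →* GL (Fin 2) ℤ := FreeGroup.lift ![upperTwo, lowerTwo]

/-- The action of `GL₂(ℤ)` on nonzero integral vectors. -/
@[reducible] def nonzeroVectorAction : MulAction (GL (Fin 2) ℤ) {v : Fin 2 → ℤ // v ≠ 0} where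
  smul M v := ⟨M.1 *ᵥ v.1, fun h => v.2 <| by
    have : M.2 *ᵥ (M.1 *ᵥ v.1) = v.1 := by rw [Matrix.mulVec_mulVec, M.inv_val, Matrix.one_mulVec]
    rw [← this, h, Matrix.mulVec_zero]⟩
  one_smul v := Subtype.ext (Matrix.one_mulVec v.1)
  mul_smul M N v := Subtype.ext (Matrix.mulVec_mulVec v.1 M.1 N.1).symm

theorem sanov_injective : Function.Injective sanov := by
  let := nonzeroVectorAction
  have hval : ∀ (M : GL (Fin 2) ℤ) (v : {v : Fin 2 → ℤ // v ≠ 0}), (M • v).1 = M.1 *ᵥ v.1 :=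
    fun _ _ => rfl
  have hne : ∀ v : {v : Fin 2 → ℤ // v ≠ 0}, v.1 0 = 0 → v.1 1 = 0 → False := by
    intro v h0 h1
    exact v.2 (by ext i; fin_cases i <;> simp [h0, h1])
  -- In terms of the ratio `t = v 0 / v 1`, the sets are `X 0 = [1, ∞]`, `X 1 = [0, 1)`, `Y 0 = (-∞,
  -- -1)` and `Y 1 = [-1, 0)`; the generators act by `t ↦ t + 2` and `1/t ↦ 1/t + 2`.
  let X : Fin 2 → Set {v : Fin 2 → ℤ // v ≠ 0} :=
    ![{v | v.1 1 * v.1 1 ≤ v.1 0 * v.1 1}, {v | v.1 0 * v.1 0 < v.1 0 * v.1 1 ∨ v.1 0 = 0}]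
  let Y : Fin 2 → Set {v : Fin 2 → ℤ // v ≠ 0} :=
    ![{v | v.1 0 * v.1 1 < -(v.1 1 * v.1 1)}, {v | v.1 0 * v.1 1 ≤ -(v.1 0 * v.1 0) ∧ v.1 0 ≠ 0}]
  have hXX : Disjoint (X 0) (X 1) := by
    rw [Set.disjoint_left]
    intro v (h : v.1 1 * v.1 1 ≤ v.1 0 * v.1 1) h'
    rcases h' with (h' : v.1 0 * v.1 0 < v.1 0 * v.1 1) | (h' : v.1 0 = 0)
    · nlinarith [sq_nonneg (v.1 0 - v.1 1)]
    · rw [h'] at h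
      exact hne v h' (by nlinarith)
  have hYY : Disjoint (Y 0) (Y 1) := by
    rw [Set.disjoint_left]
    rintro v (h : v.1 0 * v.1 1 < -(v.1 1 * v.1 1)) ⟨h' : v.1 0 * v.1 1 ≤ -(v.1 0 * v.1 0), -⟩
    nlinarith [sq_nonneg (v.1 0 + v.1 1)]
  refine FreeGroup.injective_lift_of_ping_pong _ X Y ?_ ?_ ?_ ?_ ?_ ?_
  · refine Fin.forall_fin_two.2 ⟨⟨⟨![1, 0], fun h => ?_⟩, ?_⟩, ⟨⟨![0, 1], fun h => ?_⟩, ?_⟩⟩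
    · simpa using congrFun h 0
    · simp [X]
    · simpa using congrFun h 1
    · simp [X]
  · intro i j hij
    fin_cases i <;> fin_cases j
    exacts [absurd rfl hij, hXX, hXX.symm, absurd rfl hij]
  · intro i j hij
    fin_cases i <;> fin_cases j
    exacts [absurd rfl hij, hYY, hYY.symm, absurd rfl hij]
  · simp only [Fin.forall_fin_two, Set.disjoint_left]
    refine ⟨⟨?_, ?_⟩, ?_, ?_⟩
    · intro v (h : v.1 1 * v.1 1 ≤ v.1 0 * v.1 1) (h' : v.1 0 * v.1 1 < -(v.1 1 * v.1 1))
      nlinarith [mul_self_nonneg (v.1 1)]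
    · rintro v (h : v.1 1 * v.1 1 ≤ v.1 0 * v.1 1) ⟨h' : v.1 0 * v.1 1 ≤ -(v.1 0 * v.1 0), h0⟩
      nlinarith [mul_self_nonneg (v.1 1), mul_self_pos.2 h0]
    · rintro v h (h' : v.1 0 * v.1 1 < -(v.1 1 * v.1 1))
      rcases h with (h : v.1 0 * v.1 0 < v.1 0 * v.1 1) | (h : v.1 0 = 0)
      · nlinarith [mul_self_nonneg (v.1 1), mul_self_nonneg (v.1 0)]
      · rw [h] at h'
        nlinarith [mul_self_nonneg (v.1 1)]
    · rintro v h ⟨h' : v.1 0 * v.1 1 ≤ -(v.1 0 * v.1 0), h0⟩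
      rcases h with (h : v.1 0 * v.1 0 < v.1 0 * v.1 1) | (h : v.1 0 = 0)
      · nlinarith [mul_self_nonneg (v.1 0)]
      · exact h0 h
  · simp only [Fin.forall_fin_two]
    constructor
    · rintro _ ⟨v, hv, rfl⟩
      have hv : ¬ v.1 0 * v.1 1 < -(v.1 1 * v.1 1) := hv
      simp only [X, upperTwo, hval, Matrix.cons_val_zero, Set.mem_ofPred_eq, Matrix.mulVec,
        Matrix.vec2_dotProduct, Matrix.of_apply, Matrix.cons_val_one]
      linarith
    · rintro _ ⟨v, hv, rfl⟩
      have hv : ¬ (v.1 0 * v.1 1 ≤ -(v.1 0 * v.1 0) ∧ v.1 0 ≠ 0) := hv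
      simp only [X, lowerTwo, hval, Matrix.cons_val_zero, Set.mem_ofPred_eq, Matrix.mulVec,
        Matrix.vec2_dotProduct, Matrix.of_apply, Matrix.cons_val_one]
      by_cases h0 : v.1 0 = 0
      · right
        simp [h0]
      · left
        have : ¬ v.1 0 * v.1 1 ≤ -(v.1 0 * v.1 0) := fun h => hv ⟨h, h0⟩
        linarith
  · simp only [Fin.forall_fin_two]
    constructor
    · rintro _ ⟨v, hv, rfl⟩
      have hv : ¬ v.1 1 * v.1 1 ≤ v.1 0 * v.1 1 := hv
      have hinv : (upperTwo⁻¹).1 = !![1, -2; 0, 1] := rfl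
      simp only [Y, hval, Matrix.cons_val_zero, Set.mem_ofPred_eq, Pi.inv_apply, hinv,
        Matrix.mulVec, Matrix.vec2_dotProduct, Matrix.of_apply, Matrix.cons_val_one]
      linarith
    · rintro _ ⟨v, hv, rfl⟩
      have hv : ¬ (v.1 0 * v.1 0 < v.1 0 * v.1 1 ∨ v.1 0 = 0) := hv
      push Not at hv
      have hinv : (lowerTwo⁻¹).1 = !![1, 0; -2, 1] := rfl
      simp only [Y, hval, Matrix.cons_val_zero, Set.mem_ofPred_eq, Pi.inv_apply, hinv,
        Matrix.mulVec, Matrix.vec2_dotProduct, Matrix.of_apply, Matrix.cons_val_one]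
      exact ⟨by linarith, by simpa using hv.2⟩

theorem upperTwo_zpow_val (k : ℤ) : (upperTwo ^ k).1 = !![1, 2 * k; 0, 1] := by
  induction k using Int.induction_on with
  | zero => simp [Matrix.one_fin_two]
  | succ n ih =>
    rw [zpow_add_one, Units.val_mul, ih]
    simp [upperTwo]; ring
  | pred n ih =>
    rw [zpow_sub_one, Units.val_mul, ih]
    simp [upperTwo]; ring

theorem lowerTwo_zpow_val (k : ℤ) : (lowerTwo ^ k).1 = !![1, 0; 2 * k, 1] := by
  induction k using Int.induction_on with
  | zero => simp [Matrix.one_fin_two]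
  | succ n ih =>
    rw [zpow_add_one, Units.val_mul, ih]
    simp [lowerTwo]; ring
  | pred n ih =>
    rw [zpow_sub_one, Units.val_mul, ih]
    simp [lowerTwo]; ring

theorem upperTwo_mem_range_sanov : upperTwo ∈ sanov.range :=
  ⟨FreeGroup.of 0, by simp [sanov]⟩

theorem lowerTwo_mem_range_sanov : lowerTwo ∈ sanov.range :=
  ⟨FreeGroup.of 1, by simp [sanov]⟩

/-- Euclidean descent on the first column with even quotients. The condition modulo 4 survives each
step and excludes `-1` as the final corner entry. -/
theorem mem_range_sanov (n : ℕ) (M : GL (Fin 2) ℤ) (hn : (M.1 0 0).natAbs + (M.1 1 0).natAbs ≤ n)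
    (hdet : M.1 0 0 * M.1 1 1 - M.1 0 1 * M.1 1 0 = 1) (h00 : M.1 0 0 % 4 = 1)
    (h10 : M.1 1 0 % 2 = 0) (h01 : M.1 0 1 % 2 = 0) : M ∈ sanov.range := by
  induction n generalizing M with
  | zero => omega
  | succ n ih =>
    by_cases hq : M.1 1 0 = 0
    · rw [hq, mul_zero, sub_zero] at hdet
      have hp : M.1 0 0 = 1 := by
        rcases Int.eq_one_or_neg_one_of_mul_eq_one hdet with h | h <;> omega
      rw [hp, one_mul] at hdet
      have : M = upperTwo ^ (M.1 0 1 / 2) := by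
        ext i j
        rw [upperTwo_zpow_val]
        fin_cases i <;> fin_cases j <;> simp [hp, hq, hdet]
        omega
      rw [this]
      exact zpow_mem upperTwo_mem_range_sanov _
    have hU : ∀ k : ℤ, (upperTwo ^ k * M).1 = !![M.1 0 0 + 2 * k * M.1 1 0,
        M.1 0 1 + 2 * k * M.1 1 1; M.1 1 0, M.1 1 1] := by
      intro k
      rw [Units.val_mul, upperTwo_zpow_val, Matrix.eta_fin_two M.1]
      simp
    have hL : ∀ k : ℤ, (lowerTwo ^ k * M).1 = !![M.1 0 0, M.1 0 1;
        M.1 1 0 + 2 * k * M.1 0 0, M.1 1 1 + 2 * k * M.1 0 1] := by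
      intro k
      rw [Units.val_mul, lowerTwo_zpow_val, Matrix.eta_fin_two M.1]
      simp [add_comm]
    have hu : ∀ k : ℤ, (k = 1 ∨ k = -1) →
        (M.1 0 0 + 2 * k * M.1 1 0).natAbs + (M.1 1 0).natAbs ≤ n → M ∈ sanov.range := by
      intro k hk hle
      rw [← Subgroup.mul_mem_cancel_left _ (zpow_mem upperTwo_mem_range_sanov k)]
      apply ih <;> rw [hU] <;> simp
      · exact hle
      · linear_combination hdet
      · rcases hk with rfl | rfl <;> omega
      · omega
      · rcases hk with rfl | rfl <;> omega
    have hl : ∀ k : ℤ, (k = 1 ∨ k = -1) →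
        (M.1 0 0).natAbs + (M.1 1 0 + 2 * k * M.1 0 0).natAbs ≤ n → M ∈ sanov.range := by
      intro k hk hle
      rw [← Subgroup.mul_mem_cancel_left _ (zpow_mem lowerTwo_mem_range_sanov k)]
      apply ih <;> rw [hL] <;> simp
      · exact hle
      · linear_combination hdet
      · exact h00
      · rcases hk with rfl | rfl <;> omega
      · omega
    -- The two entries have opposite parity, so their absolute values differ, and changing the
    -- larger by twice the smaller strictly shrinks it.
    by_cases h : (M.1 1 0).natAbs < (M.1 0 0).natAbs
    · by_cases hs : 0 ≤ M.1 0 0 ↔ 0 ≤ M.1 1 0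
      · exact hu (-1) (by simp) (by omega)
      · exact hu 1 (by simp) (by omega)
    · by_cases hs : 0 ≤ M.1 0 0 ↔ 0 ≤ M.1 1 0
      · exact hl (-1) (by simp) (by omega)
      · exact hl 1 (by simp) (by omega)

theorem range_sanov_finiteIndex : sanov.range.FiniteIndex := by
  let π : GL (Fin 2) ℤ →* GL (Fin 2) (ZMod 4) :=
    Matrix.GeneralLinearGroup.map (Int.castRingHom (ZMod 4))
  have hle : π.ker ≤ sanov.range := by
    intro M hM
    have hent : ∀ i j, ((M.1 i j : ℤ) : ZMod 4) = (1 : Matrix (Fin 2) (Fin 2) (ZMod 4)) i j := by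
      intro i j
      have hM1 : π M = 1 := hM
      exact congrArg (fun u : GL (Fin 2) (ZMod 4) => u.1 i j) hM1
    have hmod : ∀ a b : ℤ, (a : ZMod 4) = b → a % 4 = b % 4 := fun a b h =>
      (ZMod.intCast_eq_intCast_iff' a b 4).1 h
    have h00 := hmod _ 1 (by simpa using hent 0 0)
    have h01 := hmod _ 0 (by simpa using hent 0 1)
    have h10 := hmod _ 0 (by simpa using hent 1 0)
    have h11 := hmod _ 1 (by simpa using hent 1 1)
    have hdet : M.1 0 0 * M.1 1 1 - M.1 0 1 * M.1 1 0 = 1 := by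
      have hu : IsUnit M.1.det := (Matrix.isUnit_iff_isUnit_det _).1 M.isUnit
      rw [Matrix.det_fin_two] at hu
      have h4 : (M.1 0 0 * M.1 1 1 - M.1 0 1 * M.1 1 0) % 4 = 1 := by
        rw [Int.sub_emod, Int.mul_emod, Int.mul_emod (M.1 0 1), h00, h01, h11]
        simp
      rcases Int.isUnit_iff.1 hu with h | h <;> omega
    exact mem_range_sanov _ M le_rfl hdet (by omega) (by omega) (by omega)
  have : π.ker.FiniteIndex := inferInstance
  exact Subgroup.finiteIndex_of_le hle

end Sanov

/-! ### Words of prescribed level and prescribed image in `S₅` -/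

section Congruence

/-- The units of a ring that are congruent to `1` modulo `n`. -/
def unitsCongruentOne (R : Type*) [Ring R] (n : ℕ) : Subgroup Rˣ where
  carrier := {u | ∃ t : R, (u : R) = 1 + n • t}
  one_mem' := ⟨0, by simp⟩
  mul_mem' := by
    rintro u v ⟨s, hs⟩ ⟨t, ht⟩
    refine ⟨s + t + n • (s * t), ?_⟩
    rw [Units.val_mul, hs, ht]
    simp only [mul_add, add_mul, one_mul, mul_one, smul_add, smul_mul_assoc, mul_smul_comm]
    abel
  inv_mem' := by
    rintro u ⟨t, ht⟩
    refine ⟨-(t * ↑u⁻¹), ?_⟩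
    have : (u : R) * ↑u⁻¹ = 1 := u.mul_inv
    rw [ht, add_mul, one_mul, smul_mul_assoc] at this
    rw [smul_neg, ← sub_eq_add_neg]
    exact eq_sub_of_add_eq this

theorem unitsCongruentOne_anti {R : Type*} [Ring R] {m n : ℕ} (h : m ∣ n) :
    unitsCongruentOne R n ≤ unitsCongruentOne R m := by
  obtain ⟨k, rfl⟩ := h
  rintro u ⟨t, ht⟩
  exact ⟨k • t, by rw [ht, mul_smul]⟩

theorem pow_two_pow_mem_unitsCongruentOne {R : Type*} [Ring R] {n : ℕ} {u : Rˣ}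
    (hu : u ∈ unitsCongruentOne R (2 * n)) (k : ℕ) :
    u ^ 2 ^ k ∈ unitsCongruentOne R (2 ^ k * (2 * n)) := by
  induction k with
  | zero => simpa using hu
  | succ k ih =>
    obtain ⟨t, ht⟩ := ih
    -- For even `N`, `(1 + N t)² = 1 + 2N (t + (N/2) t²)`; here `N = 2 ^ k * (2 * n)`.
    refine ⟨t + (2 ^ k * n) • (t * t), ?_⟩
    rw [pow_succ 2 k, pow_mul, sq, Units.val_mul, ht]
    simp only [mul_add, add_mul, one_mul, mul_one, smul_add, smul_mul_assoc, mul_smul_comm,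
      ← mul_smul]
    rw [show 2 ^ k * 2 * (2 * n) * (2 ^ k * n) = 2 ^ k * (2 * n) * (2 ^ k * (2 * n)) by ring,
      show 2 ^ k * 2 * (2 * n) = 2 ^ k * (2 * n) + 2 ^ k * (2 * n) by ring, add_smul]
    abel

/-- The endomorphism of the free group of rank two raising the generators to the power `s`. -/
def powGenerators (s : ℕ) : FreeGroup (Fin 2) →* FreeGroup (Fin 2) :=
  FreeGroup.lift fun i => FreeGroup.of i ^ s

theorem sanov_powGenerators_mem (s : ℕ) (w : FreeGroup (Fin 2)) :
    sanov (powGenerators s w) ∈ unitsCongruentOne (Matrix (Fin 2) (Fin 2) ℤ) (2 * s) := by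
  have hcomp : sanov.comp (powGenerators s) = FreeGroup.lift ![upperTwo ^ s, lowerTwo ^ s] := by
    ext1 i
    fin_cases i <;> simp [sanov, powGenerators]
  rw [← MonoidHom.comp_apply, hcomp]
  refine FreeGroup.range_lift_le (s := unitsCongruentOne _ (2 * s)) ?_ ⟨w, rfl⟩
  rintro _ ⟨i, rfl⟩
  fin_cases i
  · refine ⟨!![0, 1; 0, 0], ?_⟩
    have := upperTwo_zpow_val s
    rw [zpow_natCast] at this
    simp [this, Matrix.one_fin_two]
  · refine ⟨!![0, 0; 1, 0], ?_⟩
    have := lowerTwo_zpow_val s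
    rw [zpow_natCast] at this
    simp [this, Matrix.one_fin_two]

/-- A homomorphism from the free group of rank two to `S₅` sending the generators to a
`4`-cycle and a transposition. -/
def toPermFive : FreeGroup (Fin 2) →* Equiv.Perm (Fin 5) :=
  FreeGroup.lift ![finRotate 5 * Equiv.swap 3 4, Equiv.swap 3 4]

theorem toPermFive_powGenerators {s : ℕ} (hs : s % 4 = 1) (w : FreeGroup (Fin 2)) :
    toPermFive (powGenerators s w) = toPermFive w := by
  have hcomp : toPermFive.comp (powGenerators s) = toPermFive := by
    ext1 i
    have h4 : toPermFive (FreeGroup.of i) ^ 4 = 1 := by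
      fin_cases i <;> simp only [toPermFive, FreeGroup.lift_apply_of] <;> decide
    rw [MonoidHom.comp_apply, powGenerators, FreeGroup.lift_apply_of, map_pow,
      ← Nat.div_add_mod s 4, hs, pow_succ, pow_mul, h4, one_pow, one_mul]
  exact DFunLike.congr_fun hcomp w

/-- Words mapped by `toPermFive` to `3`-cycles. -/
def threeCycleWord (j : ℕ) : FreeGroup (Fin 2) :=
  FreeGroup.of 0 ^ j * ⁅FreeGroup.of (0 : Fin 2), FreeGroup.of 1⁆ * (FreeGroup.of 0 ^ j)⁻¹

set_option maxRecDepth 20000 in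
theorem toPermFive_threeCycleWord_pow (j k : ℕ) :
    toPermFive (threeCycleWord j) ^ 2 ^ (2 * k) = toPermFive (threeCycleWord j) := by
  have h3 : toPermFive (threeCycleWord j) ^ 3 = 1 := by
    rw [threeCycleWord, map_mul, map_mul, map_inv, conj_pow,
      show toPermFive ⁅FreeGroup.of (0 : Fin 2), FreeGroup.of 1⁆ ^ 3 = 1 by
        simp only [map_commutatorElement, toPermFive, FreeGroup.lift_apply_of]
        decide]
    simp
  have hk : 2 ^ (2 * k) % 3 = 1 := by
    rw [pow_mul, Nat.pow_mod]
    simp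
  rw [← Nat.div_add_mod (2 ^ (2 * k)) 3, hk, pow_succ, pow_mul, h3, one_pow, one_mul]

set_option maxRecDepth 100000 in
theorem toPermFive_commutator_ne_one :
    ⁅⁅toPermFive (threeCycleWord 0), toPermFive (threeCycleWord 1)⁆,
      ⁅toPermFive (threeCycleWord 0), toPermFive (threeCycleWord 2)⁆⁆ ≠ 1 := by
  simp only [threeCycleWord, map_commutatorElement, map_mul, map_inv, map_pow, toPermFive,
    FreeGroup.lift_apply_of]
  decide

end Congruence

/-! ### Automorphisms of `Φ` and their action on `ℤ²` -/

section Automorphisms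

/-- The automorphism `x ↦ x`, `y ↦ x² y` of the free group on `x`, `y`. -/
def upperAut : MulAut (FreeGroup (Fin 2)) :=
  MonoidHom.toMulEquiv
    (FreeGroup.lift ![FreeGroup.of 0, FreeGroup.of 0 ^ 2 * FreeGroup.of 1])
    (FreeGroup.lift ![FreeGroup.of 0, (FreeGroup.of 0 ^ 2)⁻¹ * FreeGroup.of 1])
    (by ext1 i; fin_cases i <;> simp)
    (by ext1 i; fin_cases i <;> simp)

/-- The automorphism `x ↦ y² x`, `y ↦ y` of the free group on `x`, `y`. -/
def lowerAut : MulAut (FreeGroup (Fin 2)) :=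
  MonoidHom.toMulEquiv
    (FreeGroup.lift ![FreeGroup.of 1 ^ 2 * FreeGroup.of 0, FreeGroup.of 1])
    (FreeGroup.lift ![(FreeGroup.of 1 ^ 2)⁻¹ * FreeGroup.of 0, FreeGroup.of 1])
    (by ext1 i; fin_cases i <;> simp)
    (by ext1 i; fin_cases i <;> simp)

/-- The action of the free group of rank two on the free metabelian group by lifts of the
generators of the Sanov subgroup. -/
def sanovAut : FreeGroup (Fin 2) →* MulAut FreeMetabelianGroupTwo :=
  (autQuotient (derivedSeries (FreeGroup (Fin 2)) 2)).comp (FreeGroup.lift ![upperAut, lowerAut])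

/-- The standard generators of the free metabelian group. -/
def metabelianGen (i : Fin 2) : FreeMetabelianGroupTwo := (FreeGroup.of i : FreeGroup (Fin 2))

theorem FreeMetabelianGroupTwo.hom_ext {M : Type*} [Monoid M] {f g : FreeMetabelianGroupTwo →* M}
    (h : ∀ i, f (metabelianGen i) = g (metabelianGen i)) : f = g :=
  QuotientGroup.monoidHom_ext _ (FreeGroup.ext_hom _ _ h)

/-- The abelianization map of the free metabelian group onto `ℤ²`. -/
def exponentSum : FreeMetabelianGroupTwo →* Multiplicative (Fin 2 → ℤ) :=
  QuotientGroup.lift _ (FreeGroup.lift fun i => Multiplicative.ofAdd (Pi.single i 1)) <|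
    (derivedSeries_antitone _ one_le_two).trans <| by
      rw [derivedSeries_one]
      exact Abelianization.commutator_subset_ker _

theorem exponentSum_gen (i : Fin 2) :
    exponentSum (metabelianGen i) = Multiplicative.ofAdd (Pi.single i 1) :=
  FreeGroup.lift_apply_of

/-- The matrix of the endomorphism of `ℤ²` induced by an automorphism. -/
def exponentMatrix (α : MulAut FreeMetabelianGroupTwo) : Matrix (Fin 2) (Fin 2) ℤ :=
  Matrix.of fun i j => (exponentSum (α (metabelianGen j))).toAdd i

theorem exponentSum_apply (α : MulAut FreeMetabelianGroupTwo) (g : FreeMetabelianGroupTwo) :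
    exponentSum (α g) = Multiplicative.ofAdd (exponentMatrix α *ᵥ (exponentSum g).toAdd) := by
  have : exponentSum.comp α.toMonoidHom =
      (exponentMatrix α).mulVecLin.toAddMonoidHom.toMultiplicative.comp exponentSum := by
    apply FreeMetabelianGroupTwo.hom_ext
    intro j
    apply Multiplicative.toAdd.injective
    change (exponentSum (α (metabelianGen j))).toAdd =
      exponentMatrix α *ᵥ (exponentSum (metabelianGen j)).toAdd
    rw [exponentSum_gen, toAdd_ofAdd, Matrix.mulVec_single_one]
    rfl
  exact DFunLike.congr_fun this g

/-- The action of `Aut(Φ)` on the abelianization `ℤ²` of the free metabelian group `Φ`. -/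
def autToGL : MulAut FreeMetabelianGroupTwo →* GL (Fin 2) ℤ :=
  MonoidHom.toHomUnits
    { toFun := exponentMatrix
      map_one' := by
        ext i j
        simp [exponentMatrix, exponentSum_gen, Matrix.one_apply, Pi.single_apply]
      map_mul' := fun α β => by
        ext i j
        change (exponentSum (α (β (metabelianGen j)))).toAdd i = _
        rw [exponentSum_apply]
        rfl }

theorem autToGL_val (α : MulAut FreeMetabelianGroupTwo) : (autToGL α).1 = exponentMatrix α := rfl

theorem autToGL_sanovAut (w : FreeGroup (Fin 2)) : autToGL (sanovAut w) = sanov w := by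
  have h : autToGL.comp sanovAut = sanov := by
    ext1 i
    apply Units.ext
    have hval : ∀ (τ : MulAut (FreeGroup (Fin 2))) (a b : Fin 2),
        exponentMatrix (autQuotient (derivedSeries (FreeGroup (Fin 2)) 2) τ) a b =
          (FreeGroup.lift (fun i => Multiplicative.ofAdd (Pi.single i 1 : Fin 2 → ℤ))
            (τ (FreeGroup.of b))).toAdd a := fun _ _ _ => rfl
    ext a b
    fin_cases i
    · change exponentMatrix (autQuotient _ (FreeGroup.lift _ (FreeGroup.of 0))) a b = _
      rw [FreeGroup.lift_apply_of, hval]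
      fin_cases a <;> fin_cases b <;> simp [sanov, upperTwo, upperAut]
    · change exponentMatrix (autQuotient _ (FreeGroup.lift _ (FreeGroup.of 1))) a b = _
      rw [FreeGroup.lift_apply_of, hval]
      fin_cases a <;> fin_cases b <;> simp [sanov, lowerTwo, lowerAut]
  exact DFunLike.congr_fun h w

theorem derivedSeries_freeMetabelian : derivedSeries FreeMetabelianGroupTwo 2 = ⊥ := by
  rw [← map_derivedSeries_eq (QuotientGroup.mk'_surjective _), QuotientGroup.map_mk'_self]

theorem closure_metabelianGen :
    Subgroup.closure {metabelianGen 0, metabelianGen 1} = (⊤ : Subgroup FreeMetabelianGroupTwo) := by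
  have h := congrArg (Subgroup.map (QuotientGroup.mk' (derivedSeries (FreeGroup (Fin 2)) 2)))
    (FreeGroup.closure_range_of (Fin 2))
  rw [MonoidHom.map_closure, Subgroup.map_top_of_surjective _ (QuotientGroup.mk'_surjective _),
    ← Set.range_comp] at h
  rw [← h]
  congr 1
  ext z
  constructor
  · rintro (rfl | rfl)
    exacts [⟨0, rfl⟩, ⟨1, rfl⟩]
  · rintro ⟨i, rfl⟩
    fin_cases i
    exacts [Or.inl rfl, Or.inr rfl]

/-- An automorphism of the free metabelian group that acts on `ℤ²` trivially modulo the order of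
a finite quotient acts trivially on the abelianization of that quotient. -/
theorem autQuotient_mem_torelli (K : Subgroup FreeMetabelianGroupTwo) [K.Characteristic]
    {α : MulAut FreeMetabelianGroupTwo}
    (hα : autToGL α ∈ unitsCongruentOne _ (Nat.card (FreeMetabelianGroupTwo ⧸ K))) :
    autQuotient K α ∈ torelli (FreeMetabelianGroupTwo ⧸ K) := by
  set n := Nat.card (FreeMetabelianGroupTwo ⧸ K)
  obtain ⟨N, hN⟩ := hα
  rw [autToGL_val] at hN
  let p : FreeMetabelianGroupTwo →* Abelianization (FreeMetabelianGroupTwo ⧸ K) :=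
    Abelianization.of.comp (QuotientGroup.mk' K)
  let ψ : Multiplicative (Fin 2 → ℤ) →* Abelianization (FreeMetabelianGroupTwo ⧸ K) :=
    { toFun := fun v => p (metabelianGen 0) ^ v.toAdd 0 * p (metabelianGen 1) ^ v.toAdd 1
      map_one' := by simp
      map_mul' := fun v w => by
        simp only [toAdd_mul, Pi.add_apply, zpow_add]
        exact mul_mul_mul_comm _ _ _ _ }
  have hψ : ψ.comp exponentSum = p := by
    apply FreeMetabelianGroupTwo.hom_ext
    intro i
    rw [MonoidHom.comp_apply, exponentSum_gen]
    fin_cases i <;> simp [ψ]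
  -- The exponent of the abelianization divides `n`, so the term `n • N` of the matrix has no effect
  -- there.
  have hpow : ∀ z, ψ z ^ n = 1 := by
    have : ∀ q : FreeMetabelianGroupTwo, p q ^ n = 1 := fun q => by
      change Abelianization.of (QuotientGroup.mk' K q) ^ n = 1
      rw [← map_pow, pow_card_eq_one', map_one]
    intro z
    change (p (metabelianGen 0) ^ z.toAdd 0 * p (metabelianGen 1) ^ z.toAdd 1) ^ n = 1
    rw [← map_zpow, ← map_zpow, ← map_mul, this]
  have hfix : ∀ g, p (α g) = p g := by
    intro g
    rw [← hψ, MonoidHom.comp_apply, MonoidHom.comp_apply, exponentSum_apply, hN, Matrix.add_mulVec,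
      Matrix.one_mulVec, Matrix.smul_mulVec, ofAdd_add, ofAdd_nsmul, map_mul, map_pow, hpow,
      mul_one, ofAdd_toAdd]
  intro g
  induction g using QuotientGroup.induction_on with
  | H g =>
    rw [← Abelianization.ker_of, MonoidHom.mem_ker, map_mul, map_inv, inv_mul_eq_one]
    exact (hfix g).symm

end Automorphisms

/-! ### The contradiction -/

theorem theorem1p1 : ¬ HasCSP FreeMetabelianGroupTwo := by
  intro hCSP
  have hfin : (toPermFive.ker.map sanov).FiniteIndex := by
    have := range_sanov_finiteIndex
    constructor
    rw [Subgroup.index_map]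
    have hker : (toPermFive.ker ⊔ sanov.ker).FiniteIndex := Subgroup.finiteIndex_of_le le_sup_left
    exact mul_ne_zero hker.index_ne_zero this.index_ne_zero
  have hrel := Subgroup.isFiniteRelIndex_of_finiteIndex (H := toPermFive.ker.map sanov)
    (K := autToGL.range)
  obtain ⟨K, hK, hKfin, hle⟩ := hCSP ((toPermFive.ker.map sanov).comap autToGL)
    ⟨by rw [Subgroup.index_comap]; exact Subgroup.relIndex_ne_zero⟩
  obtain ⟨k, m, hm, hcard⟩ := Nat.exists_eq_two_pow_mul_odd
    (Nat.card_pos (α := FreeMetabelianGroupTwo ⧸ K)).ne'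
  have hs : (m * m) % 4 = 1 := by
    rw [Nat.mul_mod]
    have : m % 4 = 1 ∨ m % 4 = 3 := by
      have := Nat.odd_iff.1 hm
      omega
    rcases this with h | h <;> simp [h]
  -- The generators are raised to `m * m ≡ 1 (mod 4)` to gain the odd part of the level, and the
  -- word to `4 ^ k ≡ 1 (mod 3)` to gain the 2-part; neither changes the 3-cycle in `S₅`.
  let v : ℕ → FreeGroup (Fin 2) := fun j =>
    powGenerators (m * m) (threeCycleWord j) ^ 2 ^ (2 * k)
  have hv : ∀ j, toPermFive (v j) = toPermFive (threeCycleWord j) := fun j => by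
    rw [map_pow, toPermFive_powGenerators hs, toPermFive_threeCycleWord_pow]
  have hvt : ∀ j, autQuotient K (sanovAut (v j)) ∈ torelli (FreeMetabelianGroupTwo ⧸ K) := by
    intro j
    apply autQuotient_mem_torelli
    rw [autToGL_sanovAut, map_pow, hcard]
    refine unitsCongruentOne_anti ?_
      (pow_two_pow_mem_unitsCongruentOne (sanov_powGenerators_mem _ _) _)
    exact mul_dvd_mul (pow_dvd_pow 2 (by omega)) ⟨2 * m, by ring⟩
  let u := ⁅⁅v 0, v 1⁆, ⁅v 0, v 2⁆⁆
  have hmem : sanovAut u ∈ congruenceKernel K := by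
    have hder : derivedSeries (FreeMetabelianGroupTwo ⧸ K) 2 = ⊥ := by
      rw [← map_derivedSeries_eq (QuotientGroup.mk'_surjective K), derivedSeries_freeMetabelian,
        Subgroup.map_bot]
    have hgen : Subgroup.closure {(metabelianGen 0 : FreeMetabelianGroupTwo ⧸ K),
        (metabelianGen 1 : FreeMetabelianGroupTwo ⧸ K)} = ⊤ := by
      have h := congrArg (Subgroup.map (QuotientGroup.mk' K)) closure_metabelianGen
      rwa [MonoidHom.map_closure, Subgroup.map_top_of_surjective _
        (QuotientGroup.mk'_surjective _), Set.image_pair] at h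
    change autQuotient K (sanovAut u) = 1
    rw [← Subgroup.mem_bot, ← commutator_commutator_torelli hder hgen]
    simp only [u, map_commutatorElement]
    exact Subgroup.commutator_mem_commutator
      (Subgroup.commutator_mem_commutator (hvt 0) (hvt 1))
      (Subgroup.commutator_mem_commutator (hvt 0) (hvt 2))
  -- Freeness of the Sanov group forces `w = u`, so `u` would be trivial in `S₅`.
  obtain ⟨w, hw, hwu⟩ := hle hmem
  rw [autToGL_sanovAut] at hwu
  rw [sanov_injective hwu] at hw
  apply toPermFive_commutator_ne_one
  rw [← hv, ← hv, ← hv, ← map_commutatorElement, ← map_commutatorElement, ← map_commutatorElement]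
  exact hw
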